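/- **Setting.** For each $N$ let $\Psi\in\mathbb C^{N\times M}$, $M=M(N)\ge N$, be a Vandermonde matrix $\Psi_{n,m}=\xi_m^{\,n}$ ($0\le n<N$, $0\le m<M$) with distinct nonzero nodes $\xi_m\in\mathbb C$, and let $\Phi\in\mathbb C^{N\times N}$ be an invertible banded matrix, $\Phi_{n,m}=0$ whenever $|n-m|>b$, where the bandwidth $b$ does not depend on $N$. Let $x=(x_1,x_2)\in\mathbb C^M\times\mathbb C^N$ and $y=\Psi x_1+\Phi x_2$. **Algorithm.** Given $y$, ProSparse runs through all integers $p<N/2$ and all windows $y_l,\dots,y_{l+2p-1}$ of $2p$ consecutive entries. On each window it applies Prony's method of order $p$: if the Hankel matrix $(y_{l+i+j})_{0\le i,j<p}$ is nonsingular, it computes the recurrence coefficients $h$ with $y_{l+p+i}=\sum_{j<p}h_jy_{l+i+j}$ $(0\le i<p)$; if the polynomial $X^p-\sum_{j<p} h_jX^j$ has $p$ distinct roots, all of them among the nodes $\xi_m$, it determines the vector $\tilde x_1$ supported on these nodes with $(\Psi\tilde x_1)_{l+i}=y_{l+i}$ for $0\le i<p$. It then sets $\tilde x_2=\Phi^{-1}(y-\Psi\tilde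 x_1)$ and puts $(\tilde x_1,\tilde x_2)$ on its output list if $\tilde x_2$ has at most $K$ nonzero entries. ProSparse *recovers* $x$ if $x$ is on the output list. **Statement.** Let $0<\delta\le1$, $\alpha>0$, $\beta>0$, with $\alpha<1$ if $\delta=1$, and put $$K=\lfloor\alpha N^\delta\rfloor,\qquad P=\lfloor\beta N^{1-\delta}\log N\rfloor .$$ For all large $N$ let $x=(x_1,x_2)$ be a random vector such that, almost surely, $x_1$ has exactly $P$ nonzero entries (in arbitrary positions), and such that the support of $x_2$ is uniformly distributed over the $K$-element subsets of $\{0,\dots,N-1\}$; otherwise the law of $x$ is arbitrary. Let $$\beta_c(\alpha,\delta)=\begin{cases}\dfrac{\delta}{2\alpha},&0<\delta<1,\\[2mm]\dfrac{-1}{2\log(1-\alpha)},&\delta=1.\end{cases}$$ 1. If $\beta<\beta_c(\alpha,\delta)$, then $\mathbf P(\text{ProSparse recovers }x)\to1$ as $N\to\infty$. 2. If $\beta>\beta_c(\alpha,\delta)$, and if for all large $N$, almost surely, no active column of $\Phi$ is completely cancelled (that is, for every $k$ with $x_{2,k}\ne0$ there is an $n$ with $\Phi_{n,k}\ne0$ and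 $(\Phi x_2)_n\ne0$), then $\mathbf P(\text{ProSparse recovers }x)\to0$ as $N\to\infty$. The condition in 2 always holds when $\Phi$ is the identity matrix. -/

import Mathlib

open Filter Topology MeasureTheory
open scoped Matrix

noncomputable section

/-- The set of indices of the nonzero entries of a vector. -/
def coeffSupport {n : ℕ} (x : Fin n → ℂ) : Finset (Fin n) := by
  classical exact Finset.univ.filter fun k => x k ≠ 0

/-- The `N × M` Vandermonde matrix `Ψ n m = ξ m ^ n`, `0 ≤ n < N`, `0 ≤ m < M`. -/
def vandermondeDict {M : ℕ} (N : ℕ) (ξ : Fin M → ℂ) : Matrix (Fin N) (Fin M) ℂ :=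
  Matrix.of fun n m => ξ m ^ (n : ℕ)

/-- `Φ` is banded with bandwidth `b`: `Φ n m = 0` if `m < n - b` or `m > n + b`. -/
def IsBanded {N : ℕ} (b : ℕ) (Φ : Matrix (Fin N) (Fin N) ℂ) : Prop :=
  ∀ n m : Fin N, ((m : ℕ) + b < (n : ℕ) ∨ (n : ℕ) + b < (m : ℕ)) → Φ n m = 0

/-! ### Prony's method on a window of `2 p` samples -/

/-- The `p × p` Hankel matrix `(s (i + j))` of the samples. -/
def hankelMatrix {p : ℕ} (s : Fin (2 * p) → ℂ) : Matrix (Fin p) (Fin p) ℂ :=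
  Matrix.of fun i j => s ⟨(i : ℕ) + (j : ℕ), by omega⟩

/-- The coefficients `h` of the linear recurrence `s (p + i) = ∑ j, h j * s (i + j)`, `i < p`,
obtained by solving the Hankel system. -/
def pronyRecurrence {p : ℕ} (s : Fin (2 * p) → ℂ) : Fin p → ℂ :=
  (hankelMatrix s)⁻¹ *ᵥ fun i => s ⟨p + (i : ℕ), by omega⟩

/-- The annihilating polynomial `X ^ p - ∑ j, h j X ^ j`; its roots are the estimated nodes. -/
def pronyPolynomial {p : ℕ} (s : Fin (2 * p) → ℂ) : Polynomial ℂ :=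
  Polynomial.X ^ p -
    ∑ j : Fin p, Polynomial.C (pronyRecurrence s j) * Polynomial.X ^ (j : ℕ)

/-- The atoms of the Vandermonde dictionary whose nodes are roots of the annihilating
polynomial. -/
def pronyAtoms {M p : ℕ} (ξ : Fin M → ℂ) (s : Fin (2 * p) → ℂ) : Finset (Fin M) := by
  classical exact Finset.univ.filter fun m => (pronyPolynomial s).IsRoot (ξ m)

/-- Prony's method of order `p`, run on the samples `s` of a window that starts at position `l`,
succeeds and returns the coefficient vector `a`: the Hankel system is nonsingular, the
annihilating polynomial has `p` distinct roots, all of them nodes of the dictionary, and the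
amplitudes solve the `p × p` Vandermonde system given by the first `p` samples. -/
def IsPronyEstimate {M p : ℕ} (ξ : Fin M → ℂ) (l : ℕ) (s : Fin (2 * p) → ℂ)
    (a : Fin M → ℂ) : Prop :=
  (hankelMatrix s).det ≠ 0 ∧
  (pronyAtoms ξ s).card = p ∧
  (∀ m, m ∉ pronyAtoms ξ s → a m = 0) ∧
  ∀ i : Fin p, ∑ m ∈ pronyAtoms ξ s, a m * ξ m ^ (l + (i : ℕ)) = s ⟨(i : ℕ), by omega⟩

/-- The window `y l, …, y (l + 2 p - 1)`. -/
def window {N : ℕ} (y : Fin N → ℂ) (l p : ℕ) (h : l + 2 * p ≤ N) : Fin (2 * p) → ℂ :=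
  fun i => y ⟨l + (i : ℕ), by omega⟩

/-- The output of ProSparse on the measurement `y`, for the dictionary `[Ψ, Φ]`: the algorithm
runs through all orders `p < N / 2` and all sliding windows of length `2 p`, applies Prony's
method to the window, forms the residual `y - Ψ x₁`, expands it in the basis `Φ`, and keeps the
candidate `(x₁, x₂)` if its local part `x₂` is sparse (at most `K` nonzero entries). -/
def proSparse {N M : ℕ} (ξ : Fin M → ℂ) (Φ : Matrix (Fin N) (Fin N) ℂ) (K : ℕ)
    (y : Fin N → ℂ) : Set ((Fin M → ℂ) × (Fin N → ℂ)) :=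
  {x | ∃ p l : ℕ, 2 * p < N ∧ ∃ h : l + 2 * p ≤ N,
    IsPronyEstimate ξ l (window y l p h) x.1 ∧
    x.2 = Φ⁻¹ *ᵥ (y - vandermondeDict N ξ *ᵥ x.1) ∧
    (coeffSupport x.2).card ≤ K}

/-- ProSparse recovers `x = (x₁, x₂)` from `y = Ψ x₁ + Φ x₂`. -/
def ProSparseRecovers {N M : ℕ} (ξ : Fin M → ℂ) (Φ : Matrix (Fin N) (Fin N) ℂ) (K : ℕ)
    (x₁ : Fin M → ℂ) (x₂ : Fin N → ℂ) : Prop :=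
  (x₁, x₂) ∈ proSparse ξ Φ K (vandermondeDict N ξ *ᵥ x₁ + Φ *ᵥ x₂)

/-- The support of the random vector `X` is uniformly distributed over the `K`-element subsets
of the index set (sampling of `K` positions without replacement). -/
def HasUniformSupport {Ω : Type*} [MeasurableSpace Ω] (μ : Measure Ω) {N : ℕ} (K : ℕ)
    (X : Ω → Fin N → ℂ) : Prop :=
  ∀ S : Finset (Fin N), S.card = K →
    μ.real {ω | coeffSupport (X ω) = S} = 1 / (N.choose K : ℝ)

/-- No active local atom is cancelled completely: for every `k` in the support of `x₂`, the
local part `Φ x₂` of the signal does not vanish identically on the support of the atom `k`.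
(If `Φ` is diagonal and invertible, this holds for every `x₂`.) -/
def NoHiddenAtom {N : ℕ} (Φ : Matrix (Fin N) (Fin N) ℂ) (x₂ : Fin N → ℂ) : Prop :=
  ∀ k, x₂ k ≠ 0 → ∃ n, Φ n k ≠ 0 ∧ (Φ *ᵥ x₂) n ≠ 0

/-- The number `K = ⌊α N ^ δ⌋` of active local atoms. -/
def localSparsity (α δ : ℝ) (N : ℕ) : ℕ := ⌊α * (N : ℝ) ^ δ⌋₊

/-- The number `P = ⌊β N ^ (1 - δ) log N⌋` of active Vandermonde atoms. -/
def vandermondeSparsity (β δ : ℝ) (N : ℕ) : ℕ :=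
  ⌊β * (N : ℝ) ^ (1 - δ) * Real.log N⌋₊

/-- The critical threshold, for `0 < δ ≤ 1`. -/
def criticalBeta (α δ : ℝ) : ℝ :=
  if δ = 1 then -1 / (2 * Real.log (1 - α)) else δ / (2 * α)

end

/-! Recovery amounts to a gap in the support of `x₂`. Prony's method of order `p` returns `a`
exactly when the window is a sum of exponentials with coefficient vector `a` having `p` nonzero
entries (`isPronyEstimate_of_sum_exponentials`, `IsPronyEstimate.card_and_samples`). So recovery
needs a window of length `2P` on which `Φ x₂` vanishes. By bandedness a gap of length `2P + 2b`
suffices; without hidden atoms one of length `2P - 2b` is necessary. The constant `b` is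
asymptotically invisible.

It remains to decide whether a uniform `K`-subset has a gap of length `L ∼ 2P`. A fixed interval is
missed with probability about `(1 - K/N)^L = N^(-2βκ + o(1))`, where `κ` is `localRate α δ`. About
`N^δ` intervals matter, up to logarithms, so the threshold is `2βκ = δ`.

Above the threshold a union bound applies, over a grid of step `N^(1-δ)` rather than over all `N`
positions, which would give the wrong exponent when `δ < 1` (`measureReal_proSparseRecovers_le`).
Below it, the second moment method is applied to `N / L` disjoint blocks, whose avoidance events are
negatively correlated (`le_measureReal_proSparseRecovers`). -/

theorem mem_coeffSupport {n : ℕ} {x : Fin n → ℂ} {k : Fin n} :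
    k ∈ coeffSupport x ↔ x k ≠ 0 := by
  simp [coeffSupport]

/-! ### Prony's method characterizes sums of `p` exponentials. -/

section Prony

variable {p : ℕ} {s : Fin (2 * p) → ℂ} {z d : Fin p → ℂ}

theorem mem_pronyAtoms {M : ℕ} {ξ : Fin M → ℂ} {m : Fin M} :
    m ∈ pronyAtoms ξ s ↔ (pronyPolynomial s).IsRoot (ξ m) := by
  simp [pronyAtoms]

theorem hankelMatrix_eq_vandermonde (hs : ∀ i, s i = ∑ k, d k * z k ^ (i : ℕ)) :
    hankelMatrix s =
      (Matrix.vandermonde z)ᵀ * Matrix.diagonal d * Matrix.vandermonde z := by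
  ext i j
  rw [Matrix.mul_apply]
  simp only [hankelMatrix, Matrix.of_apply, hs, Matrix.mul_diagonal, Matrix.transpose_apply,
    Matrix.vandermonde_apply]
  exact Finset.sum_congr rfl fun k _ => by ring

/-- By the factorization `Vᵀ D V`, the determinant is `∏ d k` times the squared Vandermonde
determinant. -/
theorem det_hankelMatrix_ne_zero_iff (hz : Function.Injective z)
    (hs : ∀ i, s i = ∑ k, d k * z k ^ (i : ℕ)) :
    (hankelMatrix s).det ≠ 0 ↔ ∀ k, d k ≠ 0 := by
  have hV := Matrix.det_vandermonde_ne_zero_iff.2 hz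
  rw [hankelMatrix_eq_vandermonde hs]
  simp [hV, Finset.prod_eq_zero_iff]

theorem eval_pronyPolynomial (x : ℂ) :
    (pronyPolynomial s).eval x = x ^ p - ∑ j, pronyRecurrence s j * x ^ (j : ℕ) := by
  simp [pronyPolynomial, Polynomial.eval_finsetSum]

theorem degree_pronyPolynomial_tail_lt :
    (∑ j : Fin p, Polynomial.C (pronyRecurrence s j) * Polynomial.X ^ (j : ℕ)).degree <
      (p : WithBot ℕ) :=
  Polynomial.degree_sum_fin_lt _

theorem degree_pronyPolynomial : (pronyPolynomial s).degree = p := by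
  rw [pronyPolynomial, Polynomial.degree_sub_eq_left_of_degree_lt, Polynomial.degree_X_pow]
  rw [Polynomial.degree_X_pow]
  exact degree_pronyPolynomial_tail_lt

theorem natDegree_pronyPolynomial : (pronyPolynomial s).natDegree = p :=
  Polynomial.natDegree_eq_of_degree_eq_some degree_pronyPolynomial

theorem pronyPolynomial_ne_zero : pronyPolynomial s ≠ 0 := by
  intro h
  simpa [h] using degree_pronyPolynomial (s := s)

theorem card_pronyAtoms_le {M : ℕ} {ξ : Fin M → ℂ} (hξ : Function.Injective ξ) :
    (pronyAtoms ξ s).card ≤ p := by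
  classical
  rw [← Finset.card_image_of_injective _ hξ]
  calc _ ≤ (pronyPolynomial s).roots.toFinset.card := by
        refine Finset.card_le_card fun x hx => ?_
        obtain ⟨m, hm, rfl⟩ := Finset.mem_image.1 hx
        simpa [pronyPolynomial_ne_zero] using mem_pronyAtoms.1 hm
    _ ≤ _ := Multiset.toFinset_card_le _
    _ ≤ _ := (Polynomial.card_roots' _).trans natDegree_pronyPolynomial.le

theorem pronyRecurrence_spec (h : (hankelMatrix s).det ≠ 0) (i : Fin p) :
    ∑ j : Fin p, s ⟨i + j, by omega⟩ * pronyRecurrence s j = s ⟨p + i, by omega⟩ := by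
  have := Matrix.mulVec_mulVec (fun i : Fin p => s ⟨p + i, by omega⟩) (hankelMatrix s)
    (hankelMatrix s)⁻¹
  rw [Matrix.mul_nonsing_inv _ (isUnit_iff_ne_zero.2 h), Matrix.one_mulVec] at this
  exact congrFun this i

/-- The recurrence equations say that `Vᵀ D` kills the vector of values of the polynomial at the
nodes, and `Vᵀ D` is invertible. -/
theorem eval_pronyPolynomial_eq_zero (hz : Function.Injective z)
    (hs : ∀ i, s i = ∑ k, d k * z k ^ (i : ℕ)) (hd : ∀ k, d k ≠ 0) (k : Fin p) :
    (pronyPolynomial s).eval (z k) = 0 := by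
  have hH := (det_hankelMatrix_ne_zero_iff hz hs).2 hd
  have hdet : ((Matrix.vandermonde z)ᵀ * Matrix.diagonal d).det ≠ 0 := by
    simp [Matrix.det_vandermonde_ne_zero_iff.2 hz, Finset.prod_eq_zero_iff, hd]
  refine congrFun (Matrix.eq_zero_of_mulVec_eq_zero hdet
    (v := fun k => (pronyPolynomial s).eval (z k)) ?_) k
  ext i
  have hi := pronyRecurrence_spec hH i
  simp only [hs, Finset.sum_mul] at hi
  rw [Finset.sum_comm] at hi
  simp only [Matrix.mulVec, dotProduct, Matrix.mul_diagonal, Matrix.transpose_apply,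
    Matrix.vandermonde_apply, eval_pronyPolynomial, mul_sub, Finset.sum_sub_distrib,
    Finset.mul_sum, Pi.zero_apply]
  rw [sub_eq_zero]
  calc _ = ∑ k, d k * z k ^ (p + (i : ℕ)) := Finset.sum_congr rfl fun k _ => by ring
    _ = _ := hi.symm
    _ = _ := Finset.sum_congr rfl fun k _ => Finset.sum_congr rfl fun j _ => by ring

/-- Samples that follow the annihilating recurrence are determined by their first half. -/
theorem samples_eq_of_eval_pronyPolynomial_eq_zero (hH : (hankelMatrix s).det ≠ 0)
    (hz : ∀ k, (pronyPolynomial s).eval (z k) = 0)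
    (hs : ∀ i : Fin p, s ⟨i, by omega⟩ = ∑ k, d k * z k ^ (i : ℕ)) (i : Fin (2 * p)) :
    s i = ∑ k, d k * z k ^ (i : ℕ) := by
  obtain ⟨n, hn⟩ := i
  induction n using Nat.strong_induction_on with
  | _ n ih =>
    rcases lt_or_ge n p with h | h
    · exact hs ⟨n, h⟩
    · obtain ⟨i, rfl⟩ := Nat.exists_eq_add_of_le h
      have := pronyRecurrence_spec hH ⟨i, by omega⟩
      simp only at this
      rw [← this]
      have hp : ∀ k, z k ^ p = ∑ j, pronyRecurrence s j * z k ^ (j : ℕ) := fun k => by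
        have := hz k
        rwa [eval_pronyPolynomial, sub_eq_zero] at this
      calc _ = ∑ j : Fin p, (∑ k, d k * z k ^ (i + (j : ℕ))) * pronyRecurrence s j :=
            Finset.sum_congr rfl fun j _ => by rw [ih (i + j) (by omega) (by omega)]
        _ = _ := by
          simp only [Finset.sum_mul]
          rw [Finset.sum_comm]
          refine Finset.sum_congr rfl fun k _ => ?_
          simp only [pow_add, hp, Finset.sum_mul, Finset.mul_sum]
          exact Finset.sum_congr rfl fun j _ => by ring

theorem isPronyEstimate_of_sum_exponentials {M l : ℕ} {ξ : Fin M → ℂ}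
    (hξ : Function.Injective ξ) (hξ0 : ∀ m, ξ m ≠ 0) {a : Fin M → ℂ}
    (ha : (coeffSupport a).card = p)
    (hs : ∀ i, s i = ∑ m, a m * ξ m ^ (l + (i : ℕ))) : IsPronyEstimate ξ l s a := by
  have hsum : ∀ n : ℕ, ∑ m, a m * ξ m ^ n = ∑ m ∈ coeffSupport a, a m * ξ m ^ n := fun n =>
    (Finset.sum_subset (Finset.subset_univ _) fun m _ hm => by
      rw [mem_coeffSupport, not_not] at hm; simp [hm]).symm
  let e := ((coeffSupport a).equivFinOfCardEq ha).symm
  have hs' : ∀ i, s i = ∑ k, (a (e k) * ξ (e k) ^ l) * ξ (e k) ^ (i : ℕ) := fun i => by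
    rw [hs, hsum, ← Finset.sum_coe_sort,
      ← e.sum_comp fun m => a m * ξ m ^ (l + (i : ℕ))]
    exact Finset.sum_congr rfl fun k _ => by rw [pow_add, mul_assoc]
  have hz : Function.Injective fun k => ξ (e k) :=
    hξ.comp (Subtype.val_injective.comp e.injective)
  -- Starting the window at `l` rescales each amplitude by `ξ ^ l`; nonzero nodes keep it nonzero.
  have hd : ∀ k, a (e k) * ξ (e k) ^ l ≠ 0 := fun k =>
    mul_ne_zero (mem_coeffSupport.1 (e k).2) (pow_ne_zero _ (hξ0 _))
  -- The `p` active nodes are roots, and a polynomial of degree `p` has no room for others.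
  have hatoms : coeffSupport a = pronyAtoms ξ s := by
    refine Finset.eq_of_subset_of_card_le (fun m hm => ?_) ((card_pronyAtoms_le hξ).trans ha.ge)
    have := eval_pronyPolynomial_eq_zero hz hs' hd (e.symm ⟨m, hm⟩)
    rw [e.apply_symm_apply] at this
    exact mem_pronyAtoms.2 this
  refine ⟨(det_hankelMatrix_ne_zero_iff hz hs').2 hd, by rw [← hatoms, ha], fun m hm => ?_, fun i => ?_⟩
  · rwa [← hatoms, mem_coeffSupport, not_not] at hm
  · rw [← hatoms, hs, hsum]

/-- The amplitudes are fitted to the first `p` samples only; the recurrence carries the fit to the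
other `p`. Nonsingularity of the Hankel matrix then excludes zero amplitudes, so the order of the
method is forced to be the sparsity of `a`. -/
theorem IsPronyEstimate.card_and_samples {M l : ℕ} {ξ : Fin M → ℂ}
    (hξ : Function.Injective ξ) {a : Fin M → ℂ} (h : IsPronyEstimate ξ l s a) :
    (coeffSupport a).card = p ∧ ∀ i, s i = ∑ m, a m * ξ m ^ (l + (i : ℕ)) := by
  obtain ⟨hH, hcard, ha, hs⟩ := h
  have hsum : ∀ n : ℕ, ∑ m, a m * ξ m ^ n = ∑ m ∈ pronyAtoms ξ s, a m * ξ m ^ n := fun n =>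
    (Finset.sum_subset (Finset.subset_univ _) fun m _ hm => by simp [ha m hm]).symm
  let e := ((pronyAtoms ξ s).equivFinOfCardEq hcard).symm
  have hre : ∀ n : ℕ, ∑ m ∈ pronyAtoms ξ s, a m * ξ m ^ (l + n) =
      ∑ k, (a (e k) * ξ (e k) ^ l) * ξ (e k) ^ n := fun n => by
    rw [← Finset.sum_coe_sort, ← e.sum_comp fun m => a m * ξ m ^ (l + n)]
    exact Finset.sum_congr rfl fun k _ => by rw [pow_add, mul_assoc]
  have hz : Function.Injective fun k => ξ (e k) :=
    hξ.comp (Subtype.val_injective.comp e.injective)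
  have hs' := samples_eq_of_eval_pronyPolynomial_eq_zero hH
    (fun k => mem_pronyAtoms.1 (e k).2) (fun i => by rw [← hs, hre])
  have hd := (det_hankelMatrix_ne_zero_iff hz hs').1 hH
  refine ⟨?_, fun i => by rw [hs', hsum, hre]⟩
  convert hcard using 2
  ext m
  rw [mem_coeffSupport]
  refine ⟨fun hm => not_not.1 fun h => hm (ha m h), fun hm => ?_⟩
  have := hd (e.symm ⟨m, hm⟩)
  rw [e.apply_symm_apply] at this
  exact left_ne_zero_of_mul this

end Prony

/-! ### Recovery versus gaps in the support of the local part. -/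

section Recovery

variable {N M : ℕ} {ξ : Fin M → ℂ} {Φ : Matrix (Fin N) (Fin N) ℂ} {K b : ℕ}
  {x₁ : Fin M → ℂ} {x₂ : Fin N → ℂ}

theorem vandermondeDict_mulVec (n : Fin N) :
    (vandermondeDict N ξ *ᵥ x₁) n = ∑ m, x₁ m * ξ m ^ (n : ℕ) :=
  show ∑ m, ξ m ^ (n : ℕ) * x₁ m = _ from Finset.sum_congr rfl fun _ _ => mul_comm _ _

/-- Trimming `b` positions from each end of the gap leaves a window of length `2p` that no active
column of `Φ` reaches, so its samples are purely exponential. -/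
theorem proSparseRecovers_of_gap (hξ : Function.Injective ξ) (hξ0 : ∀ m, ξ m ≠ 0)
    (hΦ : IsBanded b Φ) (hΦu : IsUnit Φ) {p l : ℕ} (hx₁ : (coeffSupport x₁).card = p)
    (hx₂ : (coeffSupport x₂).card ≤ K) (hp : 2 * p < N) (hl : l + (2 * p + 2 * b) ≤ N)
    (hgap : ∀ k ∈ coeffSupport x₂, (k : ℕ) < l ∨ l + (2 * p + 2 * b) ≤ k) :
    ProSparseRecovers ξ Φ K x₁ x₂ := by
  refine ⟨p, l + b, hp, by omega, ?_, ?_, hx₂⟩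
  · refine isPronyEstimate_of_sum_exponentials hξ hξ0 hx₁ fun i => ?_
    simp only [window, Pi.add_apply, vandermondeDict_mulVec, add_eq_left]
    refine Finset.sum_eq_zero (fun k _ => ?_ : ∀ k ∈ (Finset.univ : Finset (Fin N)),
      Φ _ k * x₂ k = 0)
    by_cases hk : x₂ k = 0
    · simp [hk]
    · have := hgap k (mem_coeffSupport.2 hk)
      rw [hΦ _ k (by simp only; omega), zero_mul]
  · rw [add_sub_cancel_left, Matrix.mulVec_mulVec,
      Matrix.nonsing_inv_mul _ ((Matrix.isUnit_iff_isUnit_det _).1 hΦu), Matrix.one_mulVec]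

/-- On the successful window `Φ x₂` vanishes. An active `k` at distance at least `b` inside it would
have its whole column there, hence be a hidden atom. -/
theorem ProSparseRecovers.exists_gap (hξ : Function.Injective ξ) (hΦ : IsBanded b Φ)
    (hx₂ : NoHiddenAtom Φ x₂) {p : ℕ} (hx₁ : (coeffSupport x₁).card = p)
    (h : ProSparseRecovers ξ Φ K x₁ x₂) :
    ∃ l, l + 2 * p ≤ N ∧
      ∀ k ∈ coeffSupport x₂, (k : ℕ) < l + b ∨ l + 2 * p ≤ k + b := by
  obtain ⟨q, l, -, hl, hest, -, -⟩ := h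
  obtain ⟨hq, hs⟩ := hest.card_and_samples hξ
  obtain rfl : p = q := hx₁.symm.trans hq
  refine ⟨l, hl, fun k hk => ?_⟩
  obtain ⟨n, hn, hn'⟩ := hx₂ k (mem_coeffSupport.1 hk)
  by_contra! hc
  have hnk : ¬((k : ℕ) + b < n ∨ (n : ℕ) + b < k) := fun h => hn (hΦ n k h)
  obtain ⟨i, hi⟩ := Nat.exists_eq_add_of_le (show l ≤ n by omega)
  have := hs ⟨i, by omega⟩
  simp only [window, ← hi, Fin.eta, Pi.add_apply, vandermondeDict_mulVec, add_eq_left] at this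
  exact hn' this

end Recovery

/-! ### Ratios of binomial coefficients. -/

section Choose

theorem choose_pred_mul {n K : ℕ} (hn : n ≠ 0) :
    ((n - 1).choose K : ℝ) = n.choose K * (1 - K / n) := by
  obtain ⟨m, rfl⟩ := Nat.exists_eq_succ_of_ne_zero hn
  have h0 : ((m + 1 : ℕ) : ℝ) ≠ 0 := by positivity
  rcases le_or_gt K (m + 1) with hK | hK
  · have := Nat.choose_mul_succ_eq m K
    rw [Nat.add_one_sub_one]
    have h2 : (m.choose K : ℝ) * (m + 1 : ℕ) = (m + 1).choose K * ((m + 1 : ℕ) - K) := by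
      rw [← Nat.cast_sub hK]
      exact_mod_cast this
    rw [one_sub_div h0, ← mul_div_assoc, eq_div_iff h0, h2]
  · simp [Nat.choose_eq_zero_of_lt hK, Nat.choose_eq_zero_of_lt (show m < K by omega)]

/-- The ratio is a product of factors `1 - K / (N - i)`, the largest being the one with `i = 0`. -/
theorem choose_sub_le {N K : ℕ} (hK : K ≤ N) {L : ℕ} (hL : L ≤ N) :
    ((N - L).choose K : ℝ) ≤ N.choose K * (1 - K / N) ^ L := by
  induction L with
  | zero => simp
  | succ L ih =>
    have hNL : 0 < N - L := by omega
    have hpos : (0 : ℝ) < (N - L : ℕ) := by exact_mod_cast hNL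
    have h1 : 0 ≤ 1 - (K : ℝ) / N :=
      sub_nonneg.2 (div_le_one_of_le₀ (by exact_mod_cast hK) (Nat.cast_nonneg _))
    have h2 : 1 - (K : ℝ) / (N - L : ℕ) ≤ 1 - K / N := by
      gcongr
      omega
    rw [show N - (L + 1) = N - L - 1 by omega, choose_pred_mul hNL.ne', pow_succ, ← mul_assoc]
    exact (mul_le_mul_of_nonneg_left h2 (Nat.cast_nonneg _)).trans
      (mul_le_mul_of_nonneg_right (ih (by omega)) h1)

/-- The same product, with every factor bounded below through `R ≤ N - i`. -/
theorem le_choose_sub {N K R : ℕ} (hK : K ≤ R) (hR : 0 < R) {L : ℕ} (hL : R + L ≤ N) :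
    N.choose K * (1 - K / R : ℝ) ^ L ≤ (N - L).choose K := by
  induction L with
  | zero => simp
  | succ L ih =>
    have hNL : 0 < N - L := by omega
    have hpos : (0 : ℝ) < R := by exact_mod_cast hR
    have h1 : 0 ≤ 1 - (K : ℝ) / R :=
      sub_nonneg.2 (div_le_one_of_le₀ (by exact_mod_cast hK) (Nat.cast_nonneg _))
    have h2 : 1 - (K : ℝ) / R ≤ 1 - K / (N - L : ℕ) := by
      gcongr
      omega
    rw [show N - (L + 1) = N - L - 1 by omega, choose_pred_mul hNL.ne', pow_succ, ← mul_assoc]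
    exact (mul_le_mul_of_nonneg_right (ih (by omega)) h1).trans
      (mul_le_mul_of_nonneg_left h2 (Nat.cast_nonneg _))

/-- Negative correlation: having missed `i` positions makes it less likely for a `K`-subset to miss
`j` further ones. -/
theorem choose_sub_add_mul_le {N K i : ℕ} {j : ℕ} (hij : i + j ≤ N) :
    ((N - (i + j)).choose K : ℝ) * N.choose K ≤ (N - i).choose K * (N - j).choose K := by
  induction j with
  | zero => simp
  | succ j ih =>
    rcases lt_or_ge (N - (i + (j + 1))) K with h | h
    · rw [Nat.choose_eq_zero_of_lt h]
      simp only [Nat.cast_zero, zero_mul]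
      positivity
    · have hpos : (0 : ℝ) < (N - (i + j) : ℕ) := by
        have : 0 < N - (i + j) := by omega
        exact_mod_cast this
      have h1 : 0 ≤ 1 - (K : ℝ) / (N - (i + j) : ℕ) :=
        sub_nonneg.2 (div_le_one_of_le₀ (by gcongr; omega) hpos.le)
      have h2 : 1 - (K : ℝ) / (N - (i + j) : ℕ) ≤ 1 - K / (N - j : ℕ) := by
        gcongr
        omega
      rw [show N - (i + (j + 1)) = N - (i + j) - 1 by omega,
        show N - (j + 1) = N - j - 1 by omega, choose_pred_mul (by omega),
        choose_pred_mul (show N - j ≠ 0 by omega), mul_right_comm, ← mul_assoc]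
      exact (mul_le_mul_of_nonneg_right (ih (by omega)) h1).trans
        (mul_le_mul_of_nonneg_left h2 (by positivity))

end Choose

/-! ### Counting `K`-subsets that miss an interval. -/

section Avoid

open Finset

variable {N K : ℕ}

theorem card_filter_disjoint_powersetCard (W : Finset (Fin N)) :
    #{S ∈ powersetCard K univ | Disjoint W S} = (N - #W).choose K := by
  have : {S ∈ powersetCard K (univ : Finset (Fin N)) | Disjoint W S} = powersetCard K Wᶜ := by
    ext S
    simp [mem_powersetCard, subset_compl_iff_disjoint_left, and_comm]
  rw [this, card_powersetCard, card_compl, Fintype.card_fin]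

/-- Union bound for the number of `K`-subsets missing one of `n` sets of size `L`. -/
theorem card_filter_exists_disjoint_le {n L : ℕ} (W : Fin n → Finset (Fin N))
    (hW : ∀ j, #(W j) = L) :
    #{S ∈ powersetCard K univ | ∃ j, Disjoint (W j) S} ≤ n * (N - L).choose K := by
  have : {S ∈ powersetCard K (univ : Finset (Fin N)) | ∃ j, Disjoint (W j) S} =
      univ.biUnion fun j => {S ∈ powersetCard K univ | Disjoint (W j) S} := by
    ext S; simp
  rw [this]
  refine card_biUnion_le.trans ?_
  simp [card_filter_disjoint_powersetCard, hW]

/-- Second moment bound for the number of `K`-subsets missing one of `n` disjoint sets of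
size `L`. -/
theorem le_card_filter_exists_disjoint {n L : ℕ} (W : Fin n → Finset (Fin N))
    (hW : ∀ j, #(W j) = L) (hd : Pairwise fun i j => Disjoint (W i) (W j)) :
    (N.choose K : ℝ) * (n * (N - L).choose K) ≤
      #{S ∈ powersetCard K univ | ∃ j, Disjoint (W j) S} *
        (N.choose K + n * (N - L).choose K) := by
  set 𝒜 := powersetCard K (univ : Finset (Fin N))
  set 𝒢 := {S ∈ 𝒜 | ∃ j, Disjoint (W j) S}
  set G : ℝ := (N.choose K : ℝ)
  set g : ℝ := ((N - L).choose K : ℝ)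
  -- `Z` counts the missed sets and vanishes off `𝒢`, so its first two moments may be taken over
  -- `𝒢`.
  let Z : Finset (Fin N) → ℝ := fun S => ∑ j, if Disjoint (W j) S then 1 else 0
  have hZ0 : ∀ S ∈ 𝒜, S ∉ 𝒢 → Z S = 0 := fun S hS hS' => by
    refine Finset.sum_eq_zero fun j _ => if_neg fun h => hS' ?_
    exact mem_filter.2 ⟨hS, j, h⟩
  have h1 : ∑ S ∈ 𝒢, Z S = n * g := by
    rw [sum_subset (filter_subset _ _) hZ0, sum_comm]
    simp [Finset.sum_boole, 𝒜, card_filter_disjoint_powersetCard, hW, g]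
  have hpair : ∀ i j, ∑ S ∈ 𝒜, ((if Disjoint (W i) S then 1 else 0 : ℝ) *
      if Disjoint (W j) S then 1 else 0) * G ≤ (if i = j then g * G else 0) + g * g := by
    intro i j
    have he : ∀ S, ((if Disjoint (W i) S then 1 else 0 : ℝ) *
        if Disjoint (W j) S then 1 else 0) = if Disjoint (W i ∪ W j) S then 1 else 0 := by
      intro S
      simp only [disjoint_union_left]
      split_ifs <;> simp_all
    simp only [he]
    rw [← sum_mul, sum_boole, card_filter_disjoint_powersetCard]
    split_ifs with hij
    · subst hij
      rw [union_self, hW]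
      exact le_add_of_nonneg_right (mul_self_nonneg _)
    · have hc : #(W i ∪ W j) = L + L := by rw [card_union_of_disjoint (hd hij), hW, hW]
      have hle : L + L ≤ N := by
        rw [← hc]; exact (card_le_univ _).trans_eq (Fintype.card_fin N)
      rw [hc, zero_add]
      exact choose_sub_add_mul_le hle
  have h2 : (∑ S ∈ 𝒢, Z S ^ 2) * G ≤ n * g * G + (n * g) ^ 2 := by
    have : ∑ S ∈ 𝒢, Z S ^ 2 = ∑ S ∈ 𝒜, Z S ^ 2 :=
      sum_subset (filter_subset _ _) fun S hS hS' => by rw [hZ0 S hS hS']; simp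
    rw [this, sum_mul]
    simp only [Z, sq, sum_mul_sum]
    calc _ = ∑ i, ∑ j, ∑ S ∈ 𝒜, ((if Disjoint (W i) S then 1 else 0 : ℝ) *
          if Disjoint (W j) S then 1 else 0) * G := by
          simp only [sum_mul]
          rw [sum_comm]
          exact sum_congr rfl fun i _ => sum_comm
      _ ≤ ∑ i : Fin n, ∑ j : Fin n, ((if i = j then g * G else 0) + g * g) :=
          sum_le_sum fun i _ => sum_le_sum fun j _ => hpair i j
      _ = _ := by
          simp [sum_add_distrib]
          ring
  have hG : 0 ≤ G := Nat.cast_nonneg _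
  have hng : 0 ≤ n * g := by positivity
  -- Cauchy–Schwarz bounds the squared first moment by `#𝒢` times the second moment.
  have h3 := sq_sum_le_card_mul_sum_sq (s := 𝒢) (f := Z)
  rw [h1] at h3
  rcases hng.eq_or_lt with h0 | h0
  · rw [← h0]; simp; positivity
  · refine le_of_mul_le_mul_right ?_ h0
    calc G * (n * g) * (n * g) = (n * g) ^ 2 * G := by ring
      _ ≤ #𝒢 * (∑ S ∈ 𝒢, Z S ^ 2) * G := by gcongr
      _ = #𝒢 * ((∑ S ∈ 𝒢, Z S ^ 2) * G) := by ring
      _ ≤ #𝒢 * (n * g * G + (n * g) ^ 2) := by gcongr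
      _ = _ := by ring

/-- The interval `{a, …, a + L - 1}` of `Fin N`. -/
def finInterval (N a L : ℕ) : Finset (Fin N) := {k | a ≤ k ∧ (k : ℕ) < a + L}

theorem mem_finInterval {a L : ℕ} {k : Fin N} :
    k ∈ finInterval N a L ↔ a ≤ k ∧ (k : ℕ) < a + L := by
  simp [finInterval]

theorem card_finInterval {a L : ℕ} (h : a + L ≤ N) : #(finInterval N a L) = L := by
  have : (finInterval N a L).map Fin.valEmbedding = Finset.Ico a (a + L) := by
    ext k
    simp only [Finset.mem_map, mem_finInterval, Fin.valEmbedding_apply, mem_Ico]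
    exact ⟨by rintro ⟨k, hk, rfl⟩; exact hk, fun hk => ⟨⟨k, by omega⟩, hk, rfl⟩⟩
  rw [← card_map Fin.valEmbedding, this]
  simp

end Avoid

/-! ### From probabilities to counting. -/

section Measure

open Finset

variable {Ω : Type*} [MeasurableSpace Ω] {μ : Measure Ω} [IsProbabilityMeasure μ] {N K : ℕ}
  {X : Ω → Fin N → ℂ}

theorem measurableSet_coeffSupport_eq (hX : Measurable X) (S : Finset (Fin N)) :
    MeasurableSet {ω | coeffSupport (X ω) = S} := by
  have : {ω | coeffSupport (X ω) = S} = ⋂ k, {ω | X ω k ≠ 0 ↔ k ∈ S} := by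
    ext ω
    simp [Finset.ext_iff, mem_coeffSupport]
  rw [this]
  refine MeasurableSet.iInter fun k => ?_
  have hk : MeasurableSet {ω | X ω k ≠ 0} :=
    ((measurable_pi_apply k).comp hX) (measurableSet_singleton (0 : ℂ)).compl
  by_cases h : k ∈ S
  · simpa only [h, iff_true] using hk
  · simp only [h, iff_false]
    exact hk.compl

/-- Events depending only on the support become counts of `K`-subsets, whatever the law of the
values. -/
theorem HasUniformSupport.measureReal_mem (hX : Measurable X) (h : HasUniformSupport μ K X)
    {𝒢 : Finset (Finset (Fin N))} (h𝒢 : 𝒢 ⊆ powersetCard K univ) :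
    μ.real {ω | coeffSupport (X ω) ∈ 𝒢} = #𝒢 / N.choose K := by
  have : {ω | coeffSupport (X ω) ∈ 𝒢} = ⋃ S ∈ 𝒢, {ω | coeffSupport (X ω) = S} := by
    ext ω; simp
  rw [this, measureReal_biUnion_finset]
  · rw [sum_congr rfl fun S hS => h S (mem_powersetCard.1 (h𝒢 hS)).2]
    simp [div_eq_mul_inv]
  · intro S _ T _ hST
    exact Set.disjoint_left.2 fun ω h1 h2 => hST (h1.symm.trans h2)
  · exact fun S _ => measurableSet_coeffSupport_eq hX S

theorem HasUniformSupport.ae_card (hX : Measurable X) (h : HasUniformSupport μ K X)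
    (hK : K ≤ N) : ∀ᵐ ω ∂μ, #(coeffSupport (X ω)) = K := by
  have h1 := h.measureReal_mem hX (subset_refl _)
  rw [card_powersetCard, card_univ, Fintype.card_fin,
    div_self (by exact_mod_cast (Nat.choose_pos hK).ne')] at h1
  have hm : MeasurableSet {ω | coeffSupport (X ω) ∈ powersetCard K univ} := by
    have : {ω | coeffSupport (X ω) ∈ powersetCard K univ} =
        ⋃ S ∈ powersetCard K univ, {ω | coeffSupport (X ω) = S} := by
      ext ω; simp
    rw [this]
    exact Finset.measurableSet_biUnion _ fun S _ => measurableSet_coeffSupport_eq hX S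
  have h2 : μ {ω | coeffSupport (X ω) ∈ powersetCard K univ} = 1 := by
    rw [measureReal_def, ENNReal.toReal_eq_one_iff] at h1
    exact h1
  filter_upwards [(mem_ae_iff_prob_eq_one hm).2 h2] with ω hω
  simpa using hω

end Measure

/-! ### Asymptotics of the avoidance probability. -/

section Asymptotics

variable {α β δ : ℝ}

/-- The number of Vandermonde atoms up to a constant factor. -/
noncomputable def gapScale (δ : ℝ) (N : ℕ) : ℝ := (N : ℝ) ^ (1 - δ) * Real.log N

/-- The limit of `N ^ (1 - δ)` times the rate at which a gap in the local support dies out. -/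
noncomputable def localRate (α δ : ℝ) : ℝ := if δ = 1 then -Real.log (1 - α) else α

theorem localRate_pos (hα : 0 < α) (hα1 : δ = 1 → α < 1) : 0 < localRate α δ := by
  unfold localRate
  split_ifs with h
  · exact neg_pos.2 (Real.log_neg (by linarith [hα1 h]) (by linarith))
  · exact hα

theorem criticalBeta_eq : criticalBeta α δ = δ / (2 * localRate α δ) := by
  unfold criticalBeta localRate
  split_ifs with h
  · rw [h, mul_neg, div_neg, neg_div]
  · rfl

theorem tendsto_natCast_rpow_atTop {r : ℝ} (hr : 0 < r) :
    Tendsto (fun N : ℕ => (N : ℝ) ^ r) atTop atTop :=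
  (tendsto_rpow_atTop hr).comp tendsto_natCast_atTop_atTop

theorem tendsto_log_natCast_atTop : Tendsto (fun N : ℕ => Real.log N) atTop atTop :=
  Real.tendsto_log_atTop.comp tendsto_natCast_atTop_atTop

theorem tendsto_gapScale_atTop (hδ1 : δ ≤ 1) : Tendsto (gapScale δ) atTop atTop := by
  refine tendsto_atTop_mono' _ ?_ tendsto_log_natCast_atTop
  filter_upwards [eventually_ge_atTop 1] with N hN
  have hN' : (1 : ℝ) ≤ N := by exact_mod_cast hN
  exact le_mul_of_one_le_left (Real.log_nonneg hN')
    (Real.one_le_rpow hN' (sub_nonneg.2 hδ1))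

theorem tendsto_localSparsity_div (hα : 0 < α) (hδ : 0 < δ) :
    Tendsto (fun N : ℕ => (localSparsity α δ N : ℝ) / (N : ℝ) ^ δ) atTop (𝓝 α) :=
  (tendsto_nat_floor_mul_div_atTop hα.le).comp (tendsto_natCast_rpow_atTop hδ)

theorem tendsto_vandermondeSparsity_div (hβ : 0 < β) (hδ1 : δ ≤ 1) :
    Tendsto (fun N : ℕ => (vandermondeSparsity β δ N : ℝ) / gapScale δ N) atTop (𝓝 β) := by
  refine ((tendsto_nat_floor_mul_div_atTop hβ.le).comp (tendsto_gapScale_atTop hδ1)).congr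
    fun N => ?_
  simp [vandermondeSparsity, gapScale, mul_assoc]

theorem tendsto_gapScale_div (hδ : 0 < δ) :
    Tendsto (fun N : ℕ => gapScale δ N / N) atTop (𝓝 0) := by
  have h := (isLittleO_log_rpow_atTop hδ).tendsto_div_nhds_zero.comp
    (tendsto_natCast_atTop_atTop (R := ℝ))
  refine h.congr' ?_
  filter_upwards [eventually_gt_atTop 0] with N hN
  have hN' : (0 : ℝ) < N := by exact_mod_cast hN
  have := Real.rpow_pos_of_pos hN' δ
  simp only [Function.comp, gapScale]
  rw [Real.rpow_sub hN', Real.rpow_one]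
  field_simp

variable {R : ℕ → ℝ}

/-- The denominator `R N` is kept general because the upper bound uses `N` and the lower bound `N -
L N`. -/
theorem tendsto_rpow_mul_localSparsity_div (hα : 0 < α) (hδ : 0 < δ)
    (hR : Tendsto (fun N : ℕ => R N / N) atTop (𝓝 1)) :
    Tendsto (fun N : ℕ => (N : ℝ) ^ (1 - δ) * (localSparsity α δ N / R N)) atTop (𝓝 α) := by
  have h := (tendsto_localSparsity_div hα hδ).div hR one_ne_zero
  rw [div_one] at h
  refine h.congr' ?_
  filter_upwards [eventually_gt_atTop 0] with N hN
  have hN' : (0 : ℝ) < N := by exact_mod_cast hN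
  have := Real.rpow_pos_of_pos hN' δ
  simp only [Pi.div_apply]
  rw [Real.rpow_sub hN', Real.rpow_one]
  rcases eq_or_ne (R N) 0 with h0 | h0
  · simp [h0]
  · field_simp

theorem tendsto_localSparsity_div_of_lt (hα : 0 < α) (hδ : 0 < δ) (hδ1 : δ < 1)
    (hR : Tendsto (fun N : ℕ => R N / N) atTop (𝓝 1)) :
    Tendsto (fun N : ℕ => localSparsity α δ N / R N) atTop (𝓝 0) := by
  have h := (tendsto_rpow_mul_localSparsity_div hα hδ hR).div_atTop
    (tendsto_natCast_rpow_atTop (sub_pos.2 hδ1))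
  refine h.congr' ?_
  filter_upwards [eventually_gt_atTop 0] with N hN
  have hN' : (0 : ℝ) < N := by exact_mod_cast hN
  rw [mul_div_cancel_left₀ _ (Real.rpow_pos_of_pos hN' _).ne']

theorem eventually_localSparsity_div_lt_one (hα : 0 < α) (hδ : 0 < δ) (hδ1 : δ ≤ 1)
    (hα1 : δ = 1 → α < 1) (hR : Tendsto (fun N : ℕ => R N / N) atTop (𝓝 1)) :
    ∀ᶠ N in atTop, (localSparsity α δ N : ℝ) / R N < 1 := by
  rcases hδ1.lt_or_eq with h | rfl
  · exact (tendsto_localSparsity_div_of_lt hα hδ h hR).eventually_lt_const one_pos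
  · have := tendsto_rpow_mul_localSparsity_div hα hδ hR
    simp only [sub_self, Real.rpow_zero, one_mul] at this
    exact this.eventually_lt_const (hα1 rfl)

/-- With `u = K / R`: for `δ < 1`, `u → 0` and `u ≤ -log (1 - u) ≤ u / (1 - u)`; for `δ = 1`, `u →
α` and continuity of the logarithm suffices. -/
theorem tendsto_rpow_mul_neg_log (hα : 0 < α) (hδ : 0 < δ) (hδ1 : δ ≤ 1)
    (hα1 : δ = 1 → α < 1) (hR : Tendsto (fun N : ℕ => R N / N) atTop (𝓝 1)) :
    Tendsto (fun N : ℕ => (N : ℝ) ^ (1 - δ) * -Real.log (1 - localSparsity α δ N / R N))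
      atTop (𝓝 (localRate α δ)) := by
  have h := tendsto_rpow_mul_localSparsity_div hα hδ hR
  rcases hδ1.lt_or_eq with hlt | rfl
  · have h0 := tendsto_localSparsity_div_of_lt hα hδ hlt hR
    have h1 : Tendsto (fun N : ℕ => (N : ℝ) ^ (1 - δ) * (localSparsity α δ N / R N) /
        (1 - localSparsity α δ N / R N)) atTop (𝓝 α) := by
      have := h.div (tendsto_const_nhds.sub h0) (by norm_num : (1 : ℝ) - 0 ≠ 0)
      rwa [sub_zero, div_one] at this
    rw [localRate, if_neg hlt.ne]
    refine tendsto_of_tendsto_of_tendsto_of_le_of_le' h h1 ?_ ?_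
    · filter_upwards [h0.eventually_lt_const one_pos] with N hN
      gcongr
      linarith [Real.log_le_sub_one_of_pos (sub_pos.2 hN)]
    · filter_upwards [h0.eventually_lt_const one_pos] with N hN
      rw [mul_div_assoc]
      gcongr
      have hpos := sub_pos.2 hN
      have := Real.one_sub_inv_le_log_of_pos hpos
      have he : (localSparsity α δ N : ℝ) / R N / (1 - localSparsity α δ N / R N) =
          (1 - localSparsity α δ N / R N)⁻¹ - 1 := by
        rw [eq_sub_iff_add_eq, ← one_div, div_add_one hpos.ne', add_sub_cancel]
      linarith
  · simp only [sub_self, Real.rpow_zero, one_mul, localRate, if_true] at h ⊢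
    exact ((tendsto_const_nhds.sub h).log (by linarith [hα1 rfl])).neg

theorem tendsto_exponent (hα : 0 < α) (hδ : 0 < δ) (hδ1 : δ ≤ 1)
    (hα1 : δ = 1 → α < 1) (hR : Tendsto (fun N : ℕ => R N / N) atTop (𝓝 1))
    {L : ℕ → ℕ} {c : ℝ} (hL : Tendsto (fun N => (L N : ℝ) / gapScale δ N) atTop (𝓝 c)) :
    Tendsto (fun N : ℕ => L N * -Real.log (1 - localSparsity α δ N / R N) / Real.log N)
      atTop (𝓝 (c * localRate α δ)) := by
  refine (hL.mul (tendsto_rpow_mul_neg_log hα hδ hδ1 hα1 hR)).congr' ?_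
  filter_upwards [eventually_gt_atTop 0] with N hN
  have hN' : (0 : ℝ) < N := by exact_mod_cast hN
  have := Real.rpow_pos_of_pos hN' (1 - δ)
  rw [gapScale]
  field_simp

theorem rpow_mul_pow_eq_exp {N : ℕ} (hN : 1 < N) {u : ℝ} (hu : u < 1) (L : ℕ) :
    (N : ℝ) ^ δ * (1 - u) ^ L =
      Real.exp ((δ - L * -Real.log (1 - u) / Real.log N) * Real.log N) := by
  have hN' : (1 : ℝ) < N := by exact_mod_cast hN
  have hlog := Real.log_pos hN'
  rw [sub_mul, div_mul_cancel₀ _ hlog.ne', mul_neg, sub_neg_eq_add, Real.exp_add,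
    Real.rpow_def_of_pos (by linarith), mul_comm δ, Real.exp_nat_mul,
    Real.exp_log (sub_pos.2 hu)]

theorem tendsto_rpow_mul_pow_zero (hα : 0 < α) (hδ : 0 < δ) (hδ1 : δ ≤ 1)
    (hα1 : δ = 1 → α < 1) (hR : Tendsto (fun N : ℕ => R N / N) atTop (𝓝 1))
    {L : ℕ → ℕ} {c : ℝ} (hL : Tendsto (fun N => (L N : ℝ) / gapScale δ N) atTop (𝓝 c))
    (hc : δ < c * localRate α δ) :
    Tendsto (fun N : ℕ => (N : ℝ) ^ δ * (1 - localSparsity α δ N / R N) ^ L N)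
      atTop (𝓝 0) := by
  have h1 := (tendsto_const_nhds (x := δ)).sub (tendsto_exponent hα hδ hδ1 hα1 hR hL)
  have h2 := Real.tendsto_exp_atBot.comp
    (h1.neg_mul_atTop (sub_neg.2 hc) tendsto_log_natCast_atTop)
  refine h2.congr' ?_
  filter_upwards [eventually_gt_atTop 1,
    eventually_localSparsity_div_lt_one hα hδ hδ1 hα1 hR] with N hN hu
  exact (rpow_mul_pow_eq_exp hN hu _).symm

theorem tendsto_div_mul_pow_atTop (hα : 0 < α) (hδ : 0 < δ) (hδ1 : δ ≤ 1)
    (hα1 : δ = 1 → α < 1) (hR : Tendsto (fun N : ℕ => R N / N) atTop (𝓝 1))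
    {L : ℕ → ℕ} {c : ℝ} (hL : Tendsto (fun N => (L N : ℝ) / gapScale δ N) atTop (𝓝 c))
    (hc0 : 0 < c) (hc : c * localRate α δ < δ) :
    Tendsto (fun N : ℕ => (N : ℝ) / L N * (1 - localSparsity α δ N / R N) ^ L N)
      atTop atTop := by
  have h1 := (tendsto_const_nhds (x := δ)).sub (tendsto_exponent hα hδ hδ1 hα1 hR hL)
  -- The number `N / L` of blocks falls short of `N ^ δ` by a factor of order `log N`; the spare
  -- power `N ^ η` absorbs it.
  obtain ⟨η, hη0, hη⟩ := exists_between (sub_pos.2 hc)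
  have h2 := (tendsto_exp_mul_div_rpow_atTop 1 η hη0).comp tendsto_log_natCast_atTop
  have h3 : Tendsto (fun N : ℕ => (N : ℝ) ^ δ * (1 - localSparsity α δ N / R N) ^ L N /
      Real.log N) atTop atTop := by
    refine tendsto_atTop_mono' _ ?_ h2
    filter_upwards [eventually_gt_atTop 1, h1.eventually_const_lt hη,
      eventually_localSparsity_div_lt_one hα hδ hδ1 hα1 hR] with N hN hN2 hu
    have hlog := Real.log_pos (show (1 : ℝ) < N by exact_mod_cast hN)
    rw [rpow_mul_pow_eq_exp hN hu, Function.comp, Real.rpow_one]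
    gcongr
  refine (h3.atTop_mul_pos (inv_pos.2 hc0) (hL.inv₀ hc0.ne')).congr' ?_
  filter_upwards [eventually_gt_atTop 1] with N hN
  have hN' : (0 : ℝ) < N := by exact_mod_cast (zero_lt_one.trans hN)
  have hlog := Real.log_pos (show (1 : ℝ) < N by exact_mod_cast hN)
  have := Real.rpow_pos_of_pos hN' δ
  rw [gapScale, Real.rpow_sub hN', Real.rpow_one]
  field_simp

end Asymptotics

/-! ### Finite bounds for the recovery probability. -/

section Probability

variable {Ω : Type*} [MeasurableSpace Ω] {μ : Measure Ω} [IsProbabilityMeasure μ]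
  {N M K P b : ℕ} {ξ : Fin M → ℂ} {Φ : Matrix (Fin N) (Fin N) ℂ}
  {X₁ : Ω → Fin M → ℂ} {X₂ : Ω → Fin N → ℂ}

/-- A gap of length at least `t + L` contains the `L` positions from the first multiple of `t`
beyond its start. The `min` is inactive there; it only keeps the other grid windows inside `Fin N`,
so that all have `L` elements. -/
theorem exists_disjoint_window {l t L : ℕ} (ht : 0 < t) (hL : 2 * b + t + L ≤ 2 * P)
    (hl : l + 2 * P ≤ N) {S : Finset (Fin N)}
    (hS : ∀ k ∈ S, (k : ℕ) < l + b ∨ l + 2 * P ≤ k + b) :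
    ∃ j : Fin (N / t + 1), Disjoint (finInterval N (min (j * t) (N - L)) L) S := by
  have h1 := Nat.div_add_mod (l + b) t
  have h2 := Nat.mod_lt (l + b) ht
  have h3 : ((l + b) / t + 1) * t = t * ((l + b) / t) + t := by ring
  refine ⟨⟨(l + b) / t + 1, Nat.lt_succ_of_le ((Nat.le_div_iff_mul_le ht).2 (by omega))⟩, ?_⟩
  rw [Finset.disjoint_left]
  intro k hk hkS
  rw [mem_finInterval, min_eq_left (by simp only; omega)] at hk
  have := hS k hkS
  simp only at hk
  omega

/-- Union bound for the probability of recovery. -/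
theorem measureReal_proSparseRecovers_le (hξ : Function.Injective ξ) (hΦ : IsBanded b Φ)
    (hX₂m : Measurable X₂) (hX₁ : ∀ᵐ ω ∂μ, (coeffSupport (X₁ ω)).card = P)
    (hX₂ : HasUniformSupport μ K X₂) (hhid : ∀ᵐ ω ∂μ, NoHiddenAtom Φ (X₂ ω))
    {t L : ℕ} (ht : 0 < t) (hL : 2 * b + t + L ≤ 2 * P) (hLN : L ≤ N) (hK : K ≤ N) :
    μ.real {ω | ProSparseRecovers ξ Φ K (X₁ ω) (X₂ ω)} ≤
      (N / t + 1 : ℕ) * (1 - K / N : ℝ) ^ L := by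
  let W : Fin (N / t + 1) → Finset (Fin N) := fun j => finInterval N (min (j * t) (N - L)) L
  have hW : ∀ j, (W j).card = L := fun j => card_finInterval (by omega)
  let 𝒢 := {S ∈ Finset.powersetCard K (Finset.univ : Finset (Fin N)) | ∃ j, Disjoint (W j) S}
  have hC : (0 : ℝ) < N.choose K := by exact_mod_cast Nat.choose_pos hK
  calc μ.real {ω | ProSparseRecovers ξ Φ K (X₁ ω) (X₂ ω)}
      ≤ μ.real {ω | coeffSupport (X₂ ω) ∈ 𝒢} := by
        refine ENNReal.toReal_mono (measure_ne_top _ _) (measure_mono_ae ?_)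
        filter_upwards [hX₁, hhid, hX₂.ae_card hX₂m hK] with ω h1 h2 h3 h
        obtain ⟨l, hl, hS⟩ := ProSparseRecovers.exists_gap hξ hΦ h2 h1 h
        exact Finset.mem_filter.2 ⟨by simpa using h3, exists_disjoint_window ht hL hl hS⟩
    _ = 𝒢.card / N.choose K := hX₂.measureReal_mem hX₂m (Finset.filter_subset _ _)
    _ ≤ _ := by
        rw [div_le_iff₀ hC]
        calc (𝒢.card : ℝ) ≤ (N / t + 1 : ℕ) * ((N - L).choose K : ℕ) := by
              exact_mod_cast card_filter_exists_disjoint_le W hW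
          _ ≤ (N / t + 1 : ℕ) * (N.choose K * (1 - K / N : ℝ) ^ L) := by
              gcongr
              exact choose_sub_le hK hLN
          _ = _ := by ring

/-- Second moment bound for the probability of recovery. -/
theorem le_measureReal_proSparseRecovers (hξ : Function.Injective ξ) (hξ0 : ∀ m, ξ m ≠ 0)
    (hΦ : IsBanded b Φ) (hΦu : IsUnit Φ)
    (hX₂m : Measurable X₂) (hX₁ : ∀ᵐ ω ∂μ, (coeffSupport (X₁ ω)).card = P)
    (hX₂ : HasUniformSupport μ K X₂) (hP : 2 * P < N) {n R : ℕ}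
    (hn : n * (2 * P + 2 * b) ≤ N) (hK : K ≤ R) (hR : 0 < R) (hRN : R + (2 * P + 2 * b) ≤ N) :
    1 - (1 + n * (1 - K / R : ℝ) ^ (2 * P + 2 * b))⁻¹ ≤
      μ.real {ω | ProSparseRecovers ξ Φ K (X₁ ω) (X₂ ω)} := by
  set L := 2 * P + 2 * b with hLdef
  have hKN : K ≤ N := by omega
  let W : Fin n → Finset (Fin N) := fun j => finInterval N (j * L) L
  have hjL : ∀ j : Fin n, j * L + L ≤ N := fun j =>
    (Nat.succ_mul (j : ℕ) L).symm.le.trans ((Nat.mul_le_mul_right _ j.2).trans hn)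
  have hW : ∀ j, (W j).card = L := fun j => card_finInterval (hjL j)
  have hdlt : ∀ i j : Fin n, i < j → Disjoint (W i) (W j) := fun i j hij => by
    rw [Finset.disjoint_left]
    intro k hk hk'
    rw [mem_finInterval] at hk hk'
    have := Nat.mul_le_mul_right L (Nat.succ_le_of_lt (Fin.lt_def.1 hij))
    rw [Nat.succ_mul] at this
    omega
  have hd : Pairwise fun i j => Disjoint (W i) (W j) := fun i j hij =>
    hij.lt_or_gt.elim (hdlt i j) fun h => (hdlt j i h).symm
  let 𝒢 := {S ∈ Finset.powersetCard K (Finset.univ : Finset (Fin N)) | ∃ j, Disjoint (W j) S}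
  have hC : (0 : ℝ) < N.choose K := by exact_mod_cast Nat.choose_pos hKN
  have h1 : 0 ≤ 1 - (K : ℝ) / R :=
    sub_nonneg.2 (div_le_one_of_le₀ (by exact_mod_cast hK) (Nat.cast_nonneg _))
  have hx := le_choose_sub (K := K) hK hR hRN
  set x : ℝ := n * (1 - K / R : ℝ) ^ L
  have hx0 : 0 ≤ x := by positivity
  -- `y` is the expected number of missed blocks and `x` a lower bound for it; the second moment
  -- gives probability at least `y / (1 + y)`, which increases in `y`.
  set y : ℝ := n * (N - L).choose K / N.choose K
  have hy : n * ((N - L).choose K : ℝ) = N.choose K * y := by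
    simp only [y]; field_simp
  have hxy : x ≤ y := by
    rw [le_div_iff₀ hC]
    calc x * N.choose K = n * (N.choose K * (1 - K / R : ℝ) ^ L) := by simp only [x]; ring
      _ ≤ _ := by gcongr
  have h2 := le_card_filter_exists_disjoint W hW hd (K := K)
  rw [hy] at h2
  calc 1 - (1 + x)⁻¹ ≤ 1 - (1 + y)⁻¹ := by gcongr
    _ ≤ 𝒢.card / N.choose K := by
        have hy0 : 0 < 1 + y := by linarith
        rw [le_div_iff₀ hC]
        refine le_of_mul_le_mul_right ?_ (mul_pos hC hy0)
        calc (1 - (1 + y)⁻¹) * N.choose K * (N.choose K * (1 + y)) =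
            N.choose K * (N.choose K * y) := by field_simp; ring
          _ ≤ 𝒢.card * (N.choose K + N.choose K * y) := h2
          _ = _ := by ring
    _ = μ.real {ω | coeffSupport (X₂ ω) ∈ 𝒢} :=
        (hX₂.measureReal_mem hX₂m (Finset.filter_subset _ _)).symm
    _ ≤ _ := by
        refine ENNReal.toReal_mono (measure_ne_top _ _) (measure_mono_ae ?_)
        filter_upwards [hX₁] with ω hω h
        obtain ⟨hc, j, hj⟩ := Finset.mem_filter.1 (show coeffSupport (X₂ ω) ∈ 𝒢 from h)
        refine proSparseRecovers_of_gap hξ hξ0 hΦ hΦu hω (Finset.mem_powersetCard.1 hc).2.le hP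
          (hjL j) fun k hk => ?_
        by_contra! hcon
        exact Finset.disjoint_left.1 hj (mem_finInterval.2 hcon) hk

end Probability

/-! ### Window lengths and grid step on the scale `N ^ (1 - δ) log N`. -/

section Thresholds

variable {α β δ : ℝ}

theorem tendsto_two_mul_vandermondeSparsity_add_div (hβ : 0 < β) (hδ1 : δ ≤ 1) (c : ℕ) :
    Tendsto (fun N => ((2 * vandermondeSparsity β δ N + c : ℕ) : ℝ) / gapScale δ N)
      atTop (𝓝 (2 * β)) := by
  have h := ((tendsto_vandermondeSparsity_div hβ hδ1).const_mul 2).add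
    ((tendsto_const_nhds (x := (c : ℝ))).div_atTop (tendsto_gapScale_atTop hδ1))
  rw [add_zero] at h
  refine h.congr fun N => ?_
  push_cast
  ring

theorem tendsto_div_natCast_of_gapScale (hδ : 0 < δ) {L : ℕ → ℕ} {c : ℝ}
    (hL : Tendsto (fun N => (L N : ℝ) / gapScale δ N) atTop (𝓝 c)) (hδ1 : δ ≤ 1) :
    Tendsto (fun N : ℕ => (L N : ℝ) / N) atTop (𝓝 0) := by
  have h := hL.mul (tendsto_gapScale_div hδ)
  rw [mul_zero] at h
  refine h.congr' ?_
  filter_upwards [(tendsto_gapScale_atTop hδ1).eventually_gt_atTop 0] with N hN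
  rw [div_mul_div_cancel₀ hN.ne']

theorem tendsto_floor_rpow_div_gapScale :
    Tendsto (fun N : ℕ => (⌊(N : ℝ) ^ (1 - δ)⌋₊ : ℝ) / gapScale δ N) atTop (𝓝 0) := by
  refine squeeze_zero' (Eventually.of_forall fun N => ?_) ?_
    tendsto_log_natCast_atTop.inv_tendsto_atTop
  · have := Real.log_natCast_nonneg N
    rw [gapScale]
    positivity
  · filter_upwards [eventually_gt_atTop 1] with N hN
    have hN' : (0 : ℝ) < N := by exact_mod_cast (zero_lt_one.trans hN)
    have hlog := Real.log_pos (show (1 : ℝ) < N by exact_mod_cast hN)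
    have hpos := Real.rpow_pos_of_pos hN' (1 - δ)
    rw [gapScale, div_le_iff₀ (by positivity), Pi.inv_apply, mul_comm, mul_assoc,
      mul_inv_cancel₀ hlog.ne', mul_one]
    exact Nat.floor_le hpos.le

theorem tendsto_atTop_of_div_gapScale (hδ1 : δ ≤ 1) {L : ℕ → ℕ} {c : ℝ} (hc : 0 < c)
    (hL : Tendsto (fun N => (L N : ℝ) / gapScale δ N) atTop (𝓝 c)) :
    Tendsto L atTop atTop := by
  rw [← tendsto_natCast_atTop_iff (R := ℝ)]
  refine (hL.pos_mul_atTop hc (tendsto_gapScale_atTop hδ1)).congr' ?_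
  filter_upwards [(tendsto_gapScale_atTop hδ1).eventually_gt_atTop 0] with N hN
  rw [div_mul_cancel₀ _ hN.ne']

/-- The floor loses at most a factor `2`, and the extra grid point costs at most another `N ^ δ`. -/
theorem natDiv_floor_rpow_add_one_le (hδ : 0 < δ) (hδ1 : δ ≤ 1) {N : ℕ} (hN : 0 < N) :
    ((N / ⌊(N : ℝ) ^ (1 - δ)⌋₊ + 1 : ℕ) : ℝ) ≤ 3 * (N : ℝ) ^ δ := by
  have hN' : (0 : ℝ) < N := by exact_mod_cast hN
  have hN1 : (1 : ℝ) ≤ N := by exact_mod_cast hN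
  have hr := Real.one_le_rpow hN1 (sub_nonneg.2 hδ1)
  have hd := Real.one_le_rpow hN1 hδ.le
  have ht1 : (1 : ℝ) ≤ ⌊(N : ℝ) ^ (1 - δ)⌋₊ := by exact_mod_cast Nat.floor_pos.2 hr
  have hlt := Nat.lt_floor_add_one ((N : ℝ) ^ (1 - δ))
  have hmul : (N : ℝ) = N ^ δ * N ^ (1 - δ) := by
    rw [← Real.rpow_add hN', add_sub_cancel, Real.rpow_one]
  have : (N : ℝ) / ⌊(N : ℝ) ^ (1 - δ)⌋₊ ≤ 2 * N ^ δ := by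
    rw [div_le_iff₀ (by linarith)]
    calc (N : ℝ) = N ^ δ * N ^ (1 - δ) := hmul
      _ ≤ N ^ δ * (2 * ⌊(N : ℝ) ^ (1 - δ)⌋₊) := by gcongr; linarith
      _ = _ := by ring
  push_cast
  linarith [Nat.cast_div_le (α := ℝ) (m := N) (n := ⌊(N : ℝ) ^ (1 - δ)⌋₊)]

end Thresholds

/-! ### The two sides of the threshold. -/

theorem proposition2
    (α β δ : ℝ) (hα : 0 < α) (hβ : 0 < β) (hδ : 0 < δ) (hδ1 : δ ≤ 1) (hα1 : δ = 1 → α < 1)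
    (b : ℕ)
    (M : ℕ → ℕ) (hM : ∀ N, N ≤ M N)
    (ξ : ∀ N, Fin (M N) → ℂ) (hξ : ∀ N, Function.Injective (ξ N)) (hξ0 : ∀ N m, ξ N m ≠ 0)
    (Φ : ∀ N, Matrix (Fin N) (Fin N) ℂ) (hΦ : ∀ N, IsBanded b (Φ N))
    (hΦu : ∀ N, IsUnit (Φ N))
    (Ω : ℕ → Type*) [∀ N, MeasurableSpace (Ω N)]
    (μ : ∀ N, Measure (Ω N)) [∀ N, IsProbabilityMeasure (μ N)]
    (X₁ : ∀ N, Ω N → Fin (M N) → ℂ) (hX₁m : ∀ N, Measurable (X₁ N))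
    (X₂ : ∀ N, Ω N → Fin N → ℂ) (hX₂m : ∀ N, Measurable (X₂ N))
    (hX₁ : ∀ᶠ N in atTop, ∀ᵐ ω ∂(μ N),
      (coeffSupport (X₁ N ω)).card = vandermondeSparsity β δ N)
    (hX₂ : ∀ᶠ N in atTop, HasUniformSupport (μ N) (localSparsity α δ N) (X₂ N)) :
    (β < criticalBeta α δ →
      Tendsto (fun N => (μ N).real
        {ω | ProSparseRecovers (ξ N) (Φ N) (localSparsity α δ N) (X₁ N ω) (X₂ N ω)})
        atTop (𝓝 1)) ∧
    (criticalBeta α δ < β →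
      (∀ᶠ N in atTop, ∀ᵐ ω ∂(μ N), NoHiddenAtom (Φ N) (X₂ N ω)) →
      Tendsto (fun N => (μ N).real
        {ω | ProSparseRecovers (ξ N) (Φ N) (localSparsity α δ N) (X₁ N ω) (X₂ N ω)})
        atTop (𝓝 0)) := by
  have hκ := localRate_pos hα hα1
  have hκ2 : 0 < 2 * localRate α δ := by positivity
  rw [criticalBeta_eq]
  refine ⟨fun hlt => ?_, fun hgt hhid => ?_⟩
  · rw [lt_div_iff₀ hκ2] at hlt
    let L : ℕ → ℕ := fun N => 2 * vandermondeSparsity β δ N + 2 * b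
    have hL : Tendsto (fun N => (L N : ℝ) / gapScale δ N) atTop (𝓝 (2 * β)) :=
      tendsto_two_mul_vandermondeSparsity_add_div hβ hδ1 (2 * b)
    have hLN := tendsto_div_natCast_of_gapScale hδ hL hδ1
    have hLtop := tendsto_atTop_of_div_gapScale hδ1 (by positivity) hL
    have hsmall : ∀ᶠ N : ℕ in atTop, 2 * L N < N := by
      filter_upwards [hLN.eventually_lt_const (show (0 : ℝ) < 1 / 2 by norm_num),
        eventually_gt_atTop 0] with N h hN
      have hN' : (0 : ℝ) < N := by exact_mod_cast hN
      rw [div_lt_div_iff₀ hN' two_pos] at h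
      have : (2 * L N : ℝ) < N := by linarith
      exact_mod_cast this
    have hR : Tendsto (fun N : ℕ => ((N - L N : ℕ) : ℝ) / N) atTop (𝓝 1) := by
      have h := (tendsto_const_nhds (x := (1 : ℝ))).sub hLN
      rw [sub_zero] at h
      refine h.congr' ?_
      filter_upwards [hsmall] with N hN
      have hN' : (0 : ℝ) < N := by exact_mod_cast (by omega : 0 < N)
      rw [Nat.cast_sub (by omega), sub_div, div_self hN'.ne']
    have hcount : Tendsto (fun N : ℕ => ((N / L N : ℕ) : ℝ) *
        (1 - localSparsity α δ N / (N - L N : ℕ)) ^ L N) atTop atTop := by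
      refine tendsto_atTop_mono' _ ?_
        ((tendsto_div_mul_pow_atTop hα hδ hδ1 hα1 hR hL (by positivity)
          (by linarith)).atTop_div_const two_pos)
      filter_upwards [hsmall, hLtop.eventually_gt_atTop 0,
        eventually_localSparsity_div_lt_one hα hδ hδ1 hα1 hR] with N hN hL0 hu
      have hu' := (sub_pos.2 hu).le
      have hL0' : (0 : ℝ) < L N := by exact_mod_cast hL0
      rw [mul_div_right_comm]
      gcongr
      -- A positive integer quotient is at least half the real one, which accounts for the division
      -- by two.
      have h1 : N < (N / L N + 1) * L N := Nat.lt_mul_of_div_lt (Nat.lt_succ_self _) hL0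
      have h2 : 1 ≤ N / L N := (Nat.one_le_div_iff hL0).2 (by omega)
      have h1' : (N : ℝ) < ((N / L N : ℕ) + 1) * L N := by exact_mod_cast h1
      have h2' : (1 : ℝ) ≤ (N / L N : ℕ) := by exact_mod_cast h2
      rw [div_div, div_le_iff₀ (by positivity)]
      nlinarith
    have hlower : Tendsto (fun N : ℕ => 1 - (1 + ((N / L N : ℕ) : ℝ) *
        (1 - localSparsity α δ N / (N - L N : ℕ)) ^ L N)⁻¹) atTop (𝓝 1) := by
      have := (tendsto_const_nhds (x := (1 : ℝ))).sub
        (tendsto_atTop_add_const_left _ 1 hcount).inv_tendsto_atTop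
      rwa [sub_zero] at this
    refine tendsto_of_tendsto_of_tendsto_of_le_of_le' hlower tendsto_const_nhds ?_
      (Eventually.of_forall fun N => measureReal_le_one)
    filter_upwards [hX₁, hX₂, hsmall,
      eventually_localSparsity_div_lt_one hα hδ hδ1 hα1 hR] with N h1 h2 hN hu
    have hR0 : (0 : ℝ) < (N - L N : ℕ) := by exact_mod_cast (by omega : 0 < N - L N)
    rw [div_lt_one hR0] at hu
    exact le_measureReal_proSparseRecovers (hξ N) (hξ0 N) (hΦ N) (hΦu N) (hX₂m N) h1 h2
      (by simp only [L] at hN; omega) (Nat.div_mul_le_self N (L N)) (by exact_mod_cast hu.le)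
      (by omega) (Nat.sub_add_cancel (by omega)).le
  · rw [div_lt_iff₀ hκ2] at hgt
    -- The step is coarse enough for `O(N ^ δ)` grid points, yet smaller than `P` by a factor of
    -- order `log N`, so shortening the windows by `t` does not change the limit `2β`.
    let t : ℕ → ℕ := fun N => ⌊(N : ℝ) ^ (1 - δ)⌋₊
    let L : ℕ → ℕ := fun N => 2 * vandermondeSparsity β δ N - (2 * b + t N)
    have hP : Tendsto (fun N => ((2 * vandermondeSparsity β δ N : ℕ) : ℝ) / gapScale δ N)
        atTop (𝓝 (2 * β)) := tendsto_two_mul_vandermondeSparsity_add_div hβ hδ1 0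
    have hbt : Tendsto (fun N => ((2 * b + t N : ℕ) : ℝ) / gapScale δ N) atTop (𝓝 0) := by
      have h := ((tendsto_const_nhds (x := ((2 * b : ℕ) : ℝ))).div_atTop
        (tendsto_gapScale_atTop hδ1)).add (tendsto_floor_rpow_div_gapScale (δ := δ))
      rw [add_zero] at h
      exact h.congr fun N => by rw [Nat.cast_add, add_div]
    -- This makes the truncated subtraction in `L` a genuine one.
    have hle : ∀ᶠ N in atTop, 2 * b + t N ≤ 2 * vandermondeSparsity β δ N := by
      filter_upwards [hbt.eventually_lt hP (by positivity),
        (tendsto_gapScale_atTop hδ1).eventually_gt_atTop 0] with N h hN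
      rw [div_lt_div_iff_of_pos_right hN] at h
      exact_mod_cast h.le
    have hL : Tendsto (fun N => (L N : ℝ) / gapScale δ N) atTop (𝓝 (2 * β)) := by
      have h := hP.sub hbt
      rw [sub_zero] at h
      refine h.congr' ?_
      filter_upwards [hle] with N hN
      rw [← sub_div, Nat.cast_sub hN]
    have hLN := tendsto_div_natCast_of_gapScale hδ hL hδ1
    have hR : Tendsto (fun N : ℕ => (N : ℝ) / N) atTop (𝓝 1) :=
      tendsto_const_nhds.congr' (by
        filter_upwards [eventually_gt_atTop 0] with N hN
        rw [div_self (by exact_mod_cast hN.ne')])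
    have hupper := (tendsto_rpow_mul_pow_zero hα hδ hδ1 hα1 hR hL (by linarith)).const_mul 3
    rw [mul_zero] at hupper
    refine tendsto_of_tendsto_of_tendsto_of_le_of_le' tendsto_const_nhds hupper
      (Eventually.of_forall fun N => measureReal_nonneg) ?_
    filter_upwards [hX₁, hX₂, hhid, hle, eventually_gt_atTop 0,
      hLN.eventually_lt_const one_pos,
      eventually_localSparsity_div_lt_one hα hδ hδ1 hα1 hR] with N h1 h2 h3 h4 hN h5 hu
    have hN' : (0 : ℝ) < N := by exact_mod_cast hN
    have hu' := (sub_pos.2 hu).le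
    rw [div_lt_one hN'] at h5 hu
    have ht : 0 < t N := Nat.floor_pos.2
      (Real.one_le_rpow (by exact_mod_cast hN) (sub_nonneg.2 hδ1))
    calc _ ≤ ((N / t N + 1 : ℕ) : ℝ) * (1 - localSparsity α δ N / N : ℝ) ^ L N :=
          measureReal_proSparseRecovers_le (hξ N) (hΦ N) (hX₂m N) h1 h2 h3 ht
            (by simp only [L]; omega) (by exact_mod_cast h5.le) (by exact_mod_cast hu.le)
      _ ≤ 3 * (N : ℝ) ^ δ * (1 - localSparsity α δ N / N : ℝ) ^ L N := by
          gcongr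
          exact natDiv_floor_rpow_add_one_le hδ hδ1 hN
      _ = _ := mul_assoc _ _ _
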